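/- Let $G$ and $H$ be discrete groups, let $\mathcal A=(A_g)_{g\in G}$ and $\mathcal B=(B_h)_{h\in H}$ be Fell bundles over $G$ and $H$, and let $\varphi\colon G\to H$ be a group homomorphism. Let $C_c(\mathcal A)$ be the convolution $*$-algebra of finitely supported sections $f$ of $\mathcal A$ and $j_g\colon A_g\to C_c(\mathcal A)$ the canonical injections. Let $\ell^2(\mathcal A)$ be the right Hilbert $A_e$-module obtained by completing $C_c(\mathcal A)$ for the inner product $\langle f_1,f_2\rangle=\sum_{h} f_1(h)^*f_2(h)$, and for $a\in A_g$ let $\lambda^{\mathcal A}_g(a)$ be the adjointable operator on $\ell^2(\mathcal A)$ with $(\lambda^{\mathcal A}_g(a)f)(h)=a\,f(g^{-1}h)$ for $f\in C_c(\mathcal A)$. The reduced cross-sectional $C^*$-algebra $C^*_r(\mathcal A)$ is the $C^*$-algebra of adjointable operators on $\ell^2(\mathcal A)$ generated by all $\lambda^{\mathcal A}_g(a)$. The full cross-sectional $C^*$-algebra $C^*(\mathcal A)$ is the completion of $C_c(\mathcal A)$ for the supremum of all $C^*$-seminorms on it; $\widehat j^{\mathcal A}_g\colon A_g\to C^*(\mathcal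 A)$ is the map induced by $j_g$, and $\Lambda^{\mathcal A}\colon C^*(\mathcal A)\to C^*_r(\mathcal A)$ is the canonical $*$-homomorphism with $\Lambda^{\mathcal A}(\widehat j^{\mathcal A}_g(a))=\lambda^{\mathcal A}_g(a)$. For $g\in G$, $E^{\mathcal A}_g\colon C^*_r(\mathcal A)\to A_g$ is the contractive linear map with $E^{\mathcal A}_g(\lambda^{\mathcal A}_g(a))=a$ for $a\in A_g$ and $E^{\mathcal A}_g(\lambda^{\mathcal A}_h(a))=0$ for $a\in A_h$, $h\neq g$. The same notation is used for $\mathcal B$. An $\mathcal A$-$\varphi$-$\mathcal B$ bundle map is a family $T=(T_g)_{g\in G}$ of bounded linear maps $T_g\colon A_g\to B_{\varphi(g)}$. It is positive definite if $$\sum_{i,j=1}^n b_i\,T_{g_i^{-1}g_j}(a_i^*a_j)\,b_j^*\in (B_e)^+$$ for all $n\in\mathbb N$, $g_1,\dots,g_n\in G$, $a_i\in A_{g_i}$ and $b_i\in B_{\varphi(g_i)}$. (1) Let $M\colon C^*_r(\mathcal A)\to C^*_r(\mathcal B)$ be a completely positive linear map. Then the maps $T_g(a)=E^{\mathcal B}_{\varphi(g)}\bigl(M(\lambda^{\mathcal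 A}_g(a))\bigr)$, $g\in G$, $a\in A_g$, form a positive definite $\mathcal A$-$\varphi$-$\mathcal B$ bundle map. (2) Let $\Phi\colon C^*(\mathcal A)\to C^*(\mathcal B)$ be a completely positive linear map. Then the maps $T_g(a)=E^{\mathcal B}_{\varphi(g)}\bigl(\Lambda^{\mathcal B}(\Phi(\widehat j^{\mathcal A}_g(a)))\bigr)$, $g\in G$, $a\in A_g$, form a positive definite $\mathcal A$-$\varphi$-$\mathcal B$ bundle map. -/

import Mathlib

open scoped DirectSum

noncomputable section

set_option linter.unusedSectionVars false

universe u v w x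

/-! ### C*-seminorms and their completions -/

/-- A C*-seminorm on a complex `*`-algebra. -/
structure CStarSeminorm (R : Type u) [NonUnitalRing R] [StarRing R] [Module ℂ R]
    extends Seminorm ℂ R where
  mul_le' : ∀ a b : R, toFun (a * b) ≤ toFun a * toFun b
  star_eq' : ∀ a : R, toFun (star a) = toFun a
  star_mul_self' : ∀ a : R, toFun (star a * a) = toFun a ^ 2

namespace CStarSeminorm

open UniformSpace (Completion)

variable {R : Type u} [NonUnitalRing R] [StarRing R] [Module ℂ R] [IsScalarTower ℂ R R]
  [SMulCommClass ℂ R R]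

/-- The algebra `R`, with the topology of the C*-seminorm `p`. -/
def Pre (_p : CStarSeminorm R) : Type u := R

variable (p : CStarSeminorm R)

instance : SeminormedAddCommGroup p.Pre :=
  AddGroupSeminorm.toSeminormedAddCommGroup (E := R) p.toSeminorm.toAddGroupSeminorm

instance : Module ℂ p.Pre := inferInstanceAs (Module ℂ R)

/-- The identity map from `R` to `p.Pre`. -/
def toPre : R ≃ₗ[ℂ] p.Pre := LinearEquiv.refl ℂ R

theorem norm_toPre (a : R) : ‖p.toPre a‖ = p.toSeminorm a := rfl

instance : NormedSpace ℂ p.Pre where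
  norm_smul_le z a := (map_smul_eq_mul p.toSeminorm z (p.toPre.symm a)).le

/-- The separated completion of `R` for the C*-seminorm `p`. -/
def Compl : Type u := Completion p.Pre

instance : NormedAddCommGroup p.Compl := inferInstanceAs (NormedAddCommGroup (Completion p.Pre))

instance : NormedSpace ℂ p.Compl := inferInstanceAs (NormedSpace ℂ (Completion p.Pre))

instance : CompleteSpace p.Compl := inferInstanceAs (CompleteSpace (Completion p.Pre))

/-- The canonical map to the completion. -/
def toComplₗ : R →ₗ[ℂ] p.Compl :=
  (UniformSpace.Completion.toComplₗᵢ (𝕜 := ℂ) (E := p.Pre)).toLinearMap ∘ₗ p.toPre.toLinearMap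

theorem norm_toComplₗ (a : R) : ‖p.toComplₗ a‖ = p.toSeminorm a :=
  UniformSpace.Completion.norm_coe (p.toPre a)

theorem denseRange_toComplₗ : DenseRange p.toComplₗ :=
  UniformSpace.Completion.denseRange_coe (α := p.Pre)

variable {p} in
theorem Compl.induction {P : p.Compl → Prop} (x : p.Compl) (hp : IsClosed {x | P x})
    (h : ∀ a, P (p.toComplₗ a)) : P x :=
  UniformSpace.Completion.induction_on x hp fun a => h (p.toPre.symm a)

/-- The product as a biadditive map into the completion. -/
def mulHom : p.Pre →+ p.Pre →+ p.Compl :=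
  AddMonoidHom.mk' (fun x => AddMonoidHom.mk'
    (fun y => p.toComplₗ (p.toPre.symm x * p.toPre.symm y))
    (fun y z => by rw [map_add, mul_add, map_add]))
    (fun x y => by
      ext z
      change p.toComplₗ (p.toPre.symm (x + y) * p.toPre.symm z) = p.toComplₗ _ + p.toComplₗ _
      rw [map_add, add_mul, map_add]
      rfl)

theorem continuous_mulHom : Continuous fun q : p.Pre × p.Pre => p.mulHom q.1 q.2 := by
  let B : p.Pre →ₗ[ℂ] p.Pre →ₗ[ℂ] p.Compl :=
    LinearMap.mk₂ ℂ (fun x y => p.mulHom x y) (fun x y z => by rw [map_add]; rfl)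
      (fun c x y => by
        change p.toComplₗ (p.toPre.symm (c • x) * p.toPre.symm y) = c • p.toComplₗ _
        rw [map_smul, smul_mul_assoc, map_smul]
        rfl)
      (fun x y z => map_add _ _ _)
      (fun c x y => by
        change p.toComplₗ (p.toPre.symm x * p.toPre.symm (c • y)) = c • p.toComplₗ _
        rw [map_smul, mul_smul_comm, map_smul]
        rfl)
  have hB : ∀ x y, ‖B x y‖ ≤ 1 * ‖x‖ * ‖y‖ := fun x y => by
    change ‖p.toComplₗ (p.toPre.symm x * p.toPre.symm y)‖ ≤ _
    rw [one_mul, norm_toComplₗ]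
    exact p.mul_le' _ _
  exact (B.mkContinuous₂ 1 hB).continuous₂

/-- The product of the completion. -/
def mulCompl (x y : p.Compl) : p.Compl :=
  ((UniformSpace.Completion.isDenseInducing_coe (α := p.Pre)).prodMap
    (UniformSpace.Completion.isDenseInducing_coe (α := p.Pre))).extend
    (fun q : p.Pre × p.Pre => p.mulHom q.1 q.2) (x, y)

theorem mulCompl_toComplₗ (a b : R) :
    p.mulCompl (p.toComplₗ a) (p.toComplₗ b) = p.toComplₗ (a * b) :=
  ((UniformSpace.Completion.isDenseInducing_coe (α := p.Pre)).prodMap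
    (UniformSpace.Completion.isDenseInducing_coe (α := p.Pre))).extend_eq
      p.continuous_mulHom (p.toPre a, p.toPre b)

theorem continuous_mulCompl' : Continuous fun q : p.Compl × p.Compl => p.mulCompl q.1 q.2 :=
  (UniformSpace.Completion.isDenseInducing_toCompl p.Pre).extend_Z_bilin
    (UniformSpace.Completion.isDenseInducing_toCompl p.Pre) p.continuous_mulHom

@[fun_prop]
theorem continuous_mulCompl {X : Type*} [TopologicalSpace X] {f g : X → p.Compl}
    (hf : Continuous f) (hg : Continuous g) : Continuous fun x => p.mulCompl (f x) (g x) :=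
  p.continuous_mulCompl'.comp (hf.prodMk hg)

theorem mulCompl_add (x y z : p.Compl) :
    p.mulCompl x (y + z) = p.mulCompl x y + p.mulCompl x z := by
  induction x using Compl.induction with
  | hp => exact isClosed_eq (by fun_prop) (by fun_prop)
  | h x =>
    induction y using Compl.induction with
    | hp => exact isClosed_eq (by fun_prop) (by fun_prop)
    | h y =>
      induction z using Compl.induction with
      | hp => exact isClosed_eq (by fun_prop) (by fun_prop)
      | h z => rw [← map_add, mulCompl_toComplₗ, mulCompl_toComplₗ, mulCompl_toComplₗ, mul_add,
          map_add]

theorem add_mulCompl (x y z : p.Compl) :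
    p.mulCompl (x + y) z = p.mulCompl x z + p.mulCompl y z := by
  induction x using Compl.induction with
  | hp => exact isClosed_eq (by fun_prop) (by fun_prop)
  | h x =>
    induction y using Compl.induction with
    | hp => exact isClosed_eq (by fun_prop) (by fun_prop)
    | h y =>
      induction z using Compl.induction with
      | hp => exact isClosed_eq (by fun_prop) (by fun_prop)
      | h z => rw [← map_add, mulCompl_toComplₗ, mulCompl_toComplₗ, mulCompl_toComplₗ, add_mul,
          map_add]

theorem norm_mulCompl_le (x y : p.Compl) : ‖p.mulCompl x y‖ ≤ ‖x‖ * ‖y‖ := by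
  induction x using Compl.induction with
  | hp => exact isClosed_le (by fun_prop) (by fun_prop)
  | h x =>
    induction y using Compl.induction with
    | hp => exact isClosed_le (by fun_prop) (by fun_prop)
    | h y =>
      rw [mulCompl_toComplₗ, norm_toComplₗ, norm_toComplₗ, norm_toComplₗ]
      exact p.mul_le' x y

instance : NonUnitalNormedRing p.Compl where
  __ := (inferInstance : NormedAddCommGroup p.Compl)
  mul := p.mulCompl
  left_distrib := p.mulCompl_add
  right_distrib := p.add_mulCompl
  zero_mul x := by
    have h := p.add_mulCompl 0 0 x
    rw [add_zero] at h
    exact left_eq_add.mp h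
  mul_zero x := by
    have h := p.mulCompl_add x 0 0
    rw [add_zero] at h
    exact left_eq_add.mp h
  mul_assoc x y z := by
    change p.mulCompl (p.mulCompl x y) z = p.mulCompl x (p.mulCompl y z)
    induction x using Compl.induction with
    | hp => exact isClosed_eq (by fun_prop) (by fun_prop)
    | h x =>
      induction y using Compl.induction with
      | hp => exact isClosed_eq (by fun_prop) (by fun_prop)
      | h y =>
        induction z using Compl.induction with
        | hp => exact isClosed_eq (by fun_prop) (by fun_prop)
        | h z => simp only [mulCompl_toComplₗ, mul_assoc]
  norm_mul_le := p.norm_mulCompl_le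

theorem toComplₗ_mul (a b : R) : p.toComplₗ (a * b) = p.toComplₗ a * p.toComplₗ b :=
  (p.mulCompl_toComplₗ a b).symm

section

variable [StarModule ℂ R]

/-- The involution of `R` as a conjugate-linear map into the completion. -/
def starₗ : R →ₗ⋆[ℂ] p.Compl where
  toFun a := p.toComplₗ (star a)
  map_add' a b := by rw [star_add, map_add]
  map_smul' z a := by rw [star_smul, map_smul]; rfl

/-- The involution of the completion. -/
def starCompl : p.Compl →L⋆[ℂ] p.Compl := p.starₗ.extendOfNorm p.toComplₗ

theorem starCompl_toComplₗ (a : R) : p.starCompl (p.toComplₗ a) = p.toComplₗ (star a) :=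
  LinearMap.extendOfNorm_eq (f := p.starₗ) p.denseRange_toComplₗ ⟨1, fun a => by
    rw [one_mul]
    change ‖p.toComplₗ (star a)‖ ≤ _
    rw [norm_toComplₗ, norm_toComplₗ]
    exact (p.star_eq' a).le⟩ a

instance : StarRing p.Compl where
  star := p.starCompl
  star_involutive x := by
    induction x using Compl.induction with
    | hp => exact isClosed_eq (by fun_prop) (by fun_prop)
    | h x => rw [starCompl_toComplₗ, starCompl_toComplₗ, star_star]
  star_mul x y := by
    induction x using Compl.induction with
    | hp =>
      exact isClosed_eq (p.starCompl.continuous.comp (continuous_id.mul continuous_const))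
        (continuous_const.mul p.starCompl.continuous)
    | h x =>
      induction y using Compl.induction with
      | hp =>
        exact isClosed_eq (p.starCompl.continuous.comp (continuous_const.mul continuous_id))
          (p.starCompl.continuous.mul continuous_const)
      | h y =>
        rw [← toComplₗ_mul, starCompl_toComplₗ, starCompl_toComplₗ, starCompl_toComplₗ,
          ← toComplₗ_mul, star_mul]
  star_add := map_add p.starCompl

theorem toComplₗ_star (a : R) : p.toComplₗ (star a) = star (p.toComplₗ a) :=
  (p.starCompl_toComplₗ a).symm

theorem continuous_star_compl : Continuous (star : p.Compl → p.Compl) :=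
  p.starCompl.continuous

instance : NonUnitalCStarAlgebra p.Compl where
  norm_mul_self_le x := by
    induction x using Compl.induction with
    | hp =>
      exact isClosed_le (by fun_prop) ((p.continuous_star_compl.mul continuous_id).norm)
    | h x =>
      rw [← toComplₗ_star, ← toComplₗ_mul, norm_toComplₗ, norm_toComplₗ, ← sq]
      exact (p.star_mul_self' x).ge
  smul_assoc z x y := by
    change (z • x) * y = z • (x * y)
    induction x using Compl.induction with
    | hp =>
      exact isClosed_eq ((continuous_const_smul z).mul continuous_const)
        ((continuous_id.mul continuous_const).const_smul z)
    | h x =>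
      induction y using Compl.induction with
      | hp =>
        exact isClosed_eq (continuous_const.mul continuous_id)
          ((continuous_const.mul continuous_id).const_smul z)
      | h y => rw [← map_smul, ← toComplₗ_mul, ← toComplₗ_mul, ← map_smul, smul_mul_assoc]
  smul_comm z x y := by
    change z • (x * y) = x * (z • y)
    induction x using Compl.induction with
    | hp =>
      exact isClosed_eq ((continuous_id.mul continuous_const).const_smul z)
        (continuous_id.mul continuous_const)
    | h x =>
      induction y using Compl.induction with
      | hp =>
        exact isClosed_eq ((continuous_const.mul continuous_id).const_smul z)
          (continuous_const.mul (continuous_const_smul z))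
      | h y => rw [← map_smul, ← toComplₗ_mul, ← toComplₗ_mul, ← map_smul, mul_smul_comm]
  star_smul z x := p.starCompl.map_smulₛₗ z x

/-- The canonical `*`-homomorphism to the completion. -/
def toCompl : R →⋆ₙₐ[ℂ] p.Compl where
  toFun := p.toComplₗ
  map_smul' := map_smul p.toComplₗ
  map_zero' := map_zero p.toComplₗ
  map_add' := map_add p.toComplₗ
  map_mul' := p.toComplₗ_mul
  map_star' := p.toComplₗ_star

theorem norm_toCompl (a : R) : ‖p.toCompl a‖ = p.toSeminorm a := p.norm_toComplₗ a

theorem denseRange_toCompl : DenseRange p.toCompl := p.denseRange_toComplₗ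

end

/-- A C*-seminorm on a C*-algebra is dominated by the norm. -/
theorem le_norm {R : Type u} [NonUnitalCStarAlgebra R] (p : CStarSeminorm R) (a : R) :
    p.toSeminorm a ≤ ‖a‖ := by
  rw [← norm_toCompl]
  exact NonUnitalStarAlgHom.norm_apply_le p.toCompl a

/-- The C*-seminorm induced by a `*`-homomorphism. -/
def comap {S : Type v} [NonUnitalRing S] [StarRing S] [Module ℂ S] [IsScalarTower ℂ S S]
    [SMulCommClass ℂ S S] (p : CStarSeminorm R)
    (F : S →⋆ₙₐ[ℂ] R) : CStarSeminorm S where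
  toSeminorm := p.toSeminorm.comp (F : S →ₗ[ℂ] R)
  mul_le' a b := by
    change p.toSeminorm (F (a * b)) ≤ p.toSeminorm (F a) * p.toSeminorm (F b)
    rw [map_mul]
    exact p.mul_le' _ _
  star_eq' a := by
    change p.toSeminorm (F (star a)) = p.toSeminorm (F a)
    rw [map_star]
    exact p.star_eq' _
  star_mul_self' a := by
    change p.toSeminorm (F (star a * a)) = p.toSeminorm (F a) ^ 2
    rw [map_mul, map_star]
    exact p.star_mul_self' _

/-- The norm of a C*-algebra as a C*-seminorm. -/
def ofNorm (R : Type u) [NonUnitalCStarAlgebra R] : CStarSeminorm R where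
  toSeminorm := normSeminorm ℂ R
  mul_le' := norm_mul_le
  star_eq' := norm_star
  star_mul_self' a := by
    change ‖star a * a‖ = ‖a‖ ^ 2
    rw [CStarRing.norm_star_mul_self, sq]

end CStarSeminorm

/-! ### Fell bundles -/

/-- A Fell bundle over a (discrete) group `G`, on a family of complex Banach spaces `(A g)`.
To avoid transports between equal fibres, the product `A g × A h → A (g * h)` and the involution
`A g → A g⁻¹` are recorded with a free target index `k` and a proof that `k` is `g * h`
(resp. `g⁻¹`). -/
class FellBundle {G : Type u} [Group G] (A : G → Type v) [∀ g, NormedAddCommGroup (A g)]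
    [∀ g, NormedSpace ℂ (A g)] [∀ g, CompleteSpace (A g)] where
  /-- the product `A g × A h → A (g * h)` -/
  mul : ∀ {g h k : G}, g * h = k → A g → A h → A k
  /-- the involution `A g → A g⁻¹` -/
  inv : ∀ {g k : G}, g⁻¹ = k → A g → A k
  mul_add : ∀ {g h k : G} (e : g * h = k) (a : A g) (b c : A h),
    mul e a (b + c) = mul e a b + mul e a c
  add_mul : ∀ {g h k : G} (e : g * h = k) (a b : A g) (c : A h),
    mul e (a + b) c = mul e a c + mul e b c
  mul_smul : ∀ {g h k : G} (e : g * h = k) (z : ℂ) (a : A g) (b : A h),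
    mul e a (z • b) = z • mul e a b
  smul_mul : ∀ {g h k : G} (e : g * h = k) (z : ℂ) (a : A g) (b : A h),
    mul e (z • a) b = z • mul e a b
  mul_assoc : ∀ {g h k gh hk l : G} (e₁ : g * h = gh) (e₂ : gh * k = l) (e₃ : h * k = hk)
    (e₄ : g * hk = l) (a : A g) (b : A h) (c : A k),
    mul e₂ (mul e₁ a b) c = mul e₄ a (mul e₃ b c)
  norm_mul_le : ∀ {g h k : G} (e : g * h = k) (a : A g) (b : A h), ‖mul e a b‖ ≤ ‖a‖ * ‖b‖
  inv_add : ∀ {g k : G} (e : g⁻¹ = k) (a b : A g), inv e (a + b) = inv e a + inv e b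
  inv_smul : ∀ {g k : G} (e : g⁻¹ = k) (z : ℂ) (a : A g),
    inv e (z • a) = (starRingEnd ℂ) z • inv e a
  inv_inv : ∀ {g k : G} (e₁ : g⁻¹ = k) (e₂ : k⁻¹ = g) (a : A g), inv e₂ (inv e₁ a) = a
  inv_mul : ∀ {g h k g' h' k' : G} (e : g * h = k) (ek : k⁻¹ = k') (eg : g⁻¹ = g')
    (eh : h⁻¹ = h') (e' : h' * g' = k') (a : A g) (b : A h),
    inv ek (mul e a b) = mul e' (inv eh b) (inv eg a)
  norm_inv : ∀ {g k : G} (e : g⁻¹ = k) (a : A g), ‖inv e a‖ = ‖a‖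
  /-- `‖a* a‖ = ‖a‖²` -/
  norm_inv_mul_self : ∀ {g k : G} (e : g⁻¹ = k) (e' : k * g = 1) (a : A g),
    ‖mul e' (inv e a) a‖ = ‖a‖ ^ 2
  /-- `a* a ≥ 0` in the C*-algebra `A 1`, i.e. `a* a = c* c` for some `c` in `A 1` -/
  inv_mul_self_nonneg : ∀ {g k : G} (e : g⁻¹ = k) (e' : k * g = 1) (a : A g),
    ∃ c : A 1, mul e' (inv e a) a = mul (mul_one 1) (inv inv_one c) c

namespace FellBundle

variable {G : Type u} [Group G] (A : G → Type v) [∀ g, NormedAddCommGroup (A g)]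
  [∀ g, NormedSpace ℂ (A g)] [∀ g, CompleteSpace (A g)] [FellBundle A]

/-! ### The fibre product and involution as linear maps -/

/-- The product of two fibres as a bilinear map. -/
def mulₗ {g h k : G} (e : g * h = k) : A g →ₗ[ℂ] A h →ₗ[ℂ] A k :=
  LinearMap.mk₂ ℂ (mul e) (add_mul e) (smul_mul e) (mul_add e) (mul_smul e)

/-- The involution of a fibre as a conjugate-linear map. -/
def invₗ {g k : G} (e : g⁻¹ = k) : A g →ₗ⋆[ℂ] A k where
  toFun := inv e
  map_add' := inv_add e
  map_smul' := inv_smul e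

variable {A}

@[simp] theorem mulₗ_apply {g h k : G} (e : g * h = k) (a : A g) (b : A h) :
    mulₗ A e a b = mul e a b := rfl

@[simp] theorem invₗ_apply {g k : G} (e : g⁻¹ = k) (a : A g) : invₗ A e a = inv e a := rfl

@[simp] theorem mul_zero {g h k : G} (e : g * h = k) (a : A g) : mul e a (0 : A h) = 0 :=
  map_zero (mulₗ A e a)

@[simp] theorem zero_mul {g h k : G} (e : g * h = k) (b : A h) : mul e (0 : A g) b = 0 := by
  rw [← mulₗ_apply, map_zero, LinearMap.zero_apply]

@[simp] theorem inv_zero {g k : G} (e : g⁻¹ = k) : inv e (0 : A g) = 0 := map_zero (invₗ A e)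

/-! ### The unit fibre -/

variable (A) in
/-- The unit fibre `A 1`, with its structure of C*-algebra. -/
def UnitFiber : Type v := A 1

instance : NormedAddCommGroup (UnitFiber A) := inferInstanceAs (NormedAddCommGroup (A 1))

instance : NormedSpace ℂ (UnitFiber A) := inferInstanceAs (NormedSpace ℂ (A 1))

instance : CompleteSpace (UnitFiber A) := inferInstanceAs (CompleteSpace (A 1))

variable (A) in
/-- The identity map from `A 1` to `UnitFiber A`. -/
def toUnit : A 1 →ₗ[ℂ] UnitFiber A := LinearMap.id (M := A 1)

variable (A) in
/-- The identity map from `UnitFiber A` to `A 1`. -/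
def ofUnit : UnitFiber A →ₗ[ℂ] A 1 := LinearMap.id (M := A 1)

@[simp] theorem toUnit_ofUnit (a : UnitFiber A) : toUnit A (ofUnit A a) = a := rfl

@[simp] theorem ofUnit_toUnit (a : A 1) : ofUnit A (toUnit A a) = a := rfl

@[simp] theorem norm_toUnit (a : A 1) : ‖toUnit A a‖ = ‖a‖ := rfl

@[simp] theorem norm_ofUnit (a : UnitFiber A) : ‖ofUnit A a‖ = ‖a‖ := rfl

instance : NonUnitalNormedRing (UnitFiber A) where
  __ := (inferInstance : NormedAddCommGroup (UnitFiber A))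
  mul a b := toUnit A (mul (mul_one 1) (ofUnit A a) (ofUnit A b))
  left_distrib := mul_add (A := A) _
  right_distrib := add_mul (A := A) _
  zero_mul := zero_mul (A := A) _
  mul_zero := mul_zero (A := A) _
  mul_assoc := mul_assoc (A := A) _ _ _ _
  norm_mul_le := norm_mul_le (A := A) _

instance : StarRing (UnitFiber A) where
  star a := toUnit A (inv inv_one (ofUnit A a))
  star_involutive := inv_inv (A := A) _ _
  star_mul := inv_mul (A := A) _ _ _ _ _
  star_add := inv_add (A := A) _

theorem ofUnit_mul (a b : UnitFiber A) :
    ofUnit A (a * b) = mul (mul_one 1) (ofUnit A a) (ofUnit A b) := rfl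

theorem ofUnit_star (a : UnitFiber A) : ofUnit A (star a) = inv inv_one (ofUnit A a) := rfl

instance : NonUnitalCStarAlgebra (UnitFiber A) where
  norm_mul_self_le a := by
    rw [← norm_ofUnit (_ * _), ofUnit_mul, ofUnit_star, norm_inv_mul_self, sq, norm_ofUnit]
  smul_assoc z a b := smul_mul (A := A) _ z a b
  smul_comm z a b := (mul_smul (A := A) _ z a b).symm
  star_smul z a := inv_smul (A := A) _ z a

/-- The usual order of a C*-algebra: `a ≤ b` iff `b - a` is self-adjoint with non-negative
spectrum. -/
instance : PartialOrder (UnitFiber A) := CStarAlgebra.spectralOrder _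

instance : StarOrderedRing (UnitFiber A) := CStarAlgebra.spectralOrderedRing _

theorem toUnit_inv_mul_self_nonneg {g k : G} (e : g⁻¹ = k) (e' : k * g = 1) (a : A g) :
    0 ≤ toUnit A (mul e' (inv e a) a) := by
  obtain ⟨c, hc⟩ := inv_mul_self_nonneg e e' a
  rw [hc]
  exact star_mul_self_nonneg (toUnit A c)

/-- `c* b c ≤ t c* c` whenever `0 ≤ b` in the unit fibre and `‖b‖ ≤ t`. -/
theorem conj_le {g k : G} (e : g⁻¹ = k) (e' : k * g = 1) (b : UnitFiber A) (hb : 0 ≤ b) (t : ℝ)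
    (ht : ‖b‖ ≤ t) (c : A g) :
    toUnit A (mul e' (inv e c) (mul (one_mul g) (ofUnit A b) c)) ≤
      (t : ℂ) • toUnit A (mul e' (inv e c) c) := by
  let _ : PartialOrder (Unitization ℂ (UnitFiber A)) := CStarAlgebra.spectralOrder _
  let _ : StarOrderedRing (Unitization ℂ (UnitFiber A)) := CStarAlgebra.spectralOrderedRing _
  have hsa : IsSelfAdjoint (b : Unitization ℂ (UnitFiber A)) :=
    (IsSelfAdjoint.of_nonneg hb).inr ℂ
  have h1 : (b : Unitization ℂ (UnitFiber A)) ≤ algebraMap ℝ _ t := by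
    refine hsa.le_algebraMap_norm_self.trans ?_
    rw [Unitization.norm_inr]
    exact algebraMap_mono _ ht
  obtain ⟨d, hd⟩ := CStarAlgebra.nonneg_iff_eq_star_mul_self.mp (sub_nonneg.mpr h1)
  have hf := congrArg (fun x => x.fst) hd
  have hs := congrArg (fun x => x.snd) hd
  have hal : (algebraMap ℝ (Unitization ℂ (UnitFiber A)) t) = Unitization.inl (t : ℂ) := rfl
  rw [hal] at hf hs
  simp only [sub_eq_add_neg, Unitization.fst_add, Unitization.fst_neg, Unitization.fst_inl,
    Unitization.fst_inr, Unitization.fst_mul,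
    Unitization.fst_star, Unitization.snd_add, Unitization.snd_neg, Unitization.snd_inl, Unitization.snd_inr,
    Unitization.snd_mul, Unitization.snd_star, neg_zero, add_zero, zero_add] at hf hs
  have hpos := toUnit_inv_mul_self_nonneg e e'
    (d.fst • c + mul (one_mul g) (ofUnit A d.snd) c)
  have key : mul e' (inv e (d.fst • c + mul (one_mul g) (ofUnit A d.snd) c))
      (d.fst • c + mul (one_mul g) (ofUnit A d.snd) c) =
      (t : ℂ) • mul e' (inv e c) c - mul e' (inv e c) (mul (one_mul g) (ofUnit A b) c) := by
    have hb' : ofUnit A b = - ofUnit A (star d.fst • d.snd + d.fst • star d.snd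
        + star d.snd * d.snd) := by
      rw [← hs, map_neg, neg_neg]
    rw [hb', hf]
    have hk : k * 1 = k := mul_one k
    have e1 : inv e (mul (one_mul g) (ofUnit A d.snd) c) =
        mul hk (inv e c) (inv inv_one (ofUnit A d.snd)) := inv_mul _ _ _ _ _ _ _
    have e2 : ∀ y : A g, mul e' (mul hk (inv e c) (inv inv_one (ofUnit A d.snd))) y =
        mul e' (inv e c) (mul (one_mul g) (inv inv_one (ofUnit A d.snd)) y) :=
      fun y => mul_assoc _ _ _ _ _ _ _
    have e3 : mul (one_mul g) (inv inv_one (ofUnit A d.snd))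
        (mul (one_mul g) (ofUnit A d.snd) c) =
        mul (one_mul g) (mul (mul_one 1) (inv inv_one (ofUnit A d.snd)) (ofUnit A d.snd)) c :=
      (mul_assoc _ _ _ _ _ _ _).symm
    rw [inv_add, inv_smul, e1, add_mul, mul_add, mul_add, e2, e2, e3, map_add, map_add,
      ofUnit_mul, ofUnit_star, map_smul, map_smul, ofUnit_star]
    simp only [← mulₗ_apply, map_neg, map_add, map_smul, LinearMap.neg_apply, LinearMap.add_apply,
      LinearMap.smul_apply]
    simp only [smul_smul, RCLike.star_def, sub_neg_eq_add]
    rw [_root_.mul_comm d.fst]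
    abel
  rw [key, map_sub, map_smul] at hpos
  exact sub_nonneg.mp hpos

/-! ### The `*`-algebra of finitely supported sections -/

variable (A) in
/-- The space of finitely supported sections of the bundle. -/
def Cc : Type max u v := ⨁ g, A g

instance : AddCommGroup (Cc A) := inferInstanceAs (AddCommGroup (⨁ g, A g))

instance : Module ℂ (Cc A) := inferInstanceAs (Module ℂ (⨁ g, A g))

variable (A) in
open scoped Classical in
/-- The canonical injection of `A g` into the finitely supported sections. -/
def j (g : G) : A g →ₗ[ℂ] Cc A := DirectSum.lof ℂ G A g

variable (A) in
/-- The value of a section at `g`. -/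
def ev (g : G) : Cc A →ₗ[ℂ] A g := DirectSum.component ℂ G A g

open scoped Classical in
/-- The support of a section. -/
def supp (f : Cc A) : Finset G := DFinsupp.support (show Π₀ g, A g from f)

open scoped Classical in
/-- The linear map on sections determined by its restrictions to the fibres. -/
def lift {M : Type w} [AddCommGroup M] [Module ℂ M] (F : ∀ g, A g →ₗ[ℂ] M) : Cc A →ₗ[ℂ] M :=
  DirectSum.toModule ℂ G M F

theorem lift_j {M : Type w} [AddCommGroup M] [Module ℂ M] (F : ∀ g, A g →ₗ[ℂ] M) (g : G)
    (a : A g) : lift F (j A g a) = F g a := by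
  classical
  exact DirectSum.toModule_lof ℂ g a

theorem ev_j_same (g : G) (a : A g) : ev A g (j A g a) = a := by
  classical
  exact DirectSum.component.lof_self ℂ g a

theorem ev_j_ne {g h : G} (hgh : g ≠ h) (a : A g) : ev A h (j A g a) = 0 := by
  classical
  exact DirectSum.of_eq_of_ne (β := A) g h a hgh.symm

theorem Cc.ext {f₁ f₂ : Cc A} (H : ∀ g, ev A g f₁ = ev A g f₂) : f₁ = f₂ :=
  DirectSum.ext_component (R := ℂ) H

theorem Cc.induction {p : Cc A → Prop} (f : Cc A) (h0 : p 0) (hj : ∀ g a, p (j A g a))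
    (hadd : ∀ f₁ f₂, p f₁ → p f₂ → p (f₁ + f₂)) : p f := by
  classical
  exact DirectSum.induction_on f h0 hj hadd

theorem eq_sum_j (f : Cc A) : f = ∑ g ∈ supp f, j A g (ev A g f) := by
  classical
  exact (DFinsupp.sum_single (f := (show Π₀ g, A g from f))).symm

theorem ev_eq_zero {f : Cc A} {g : G} (hg : g ∉ supp f) : ev A g f = 0 := by
  classical
  exact DFinsupp.notMem_support_iff.mp hg

/-- The convolution product, determined by `j g a * j h b = j (g * h) (a b)`. -/
def conv : Cc A →ₗ[ℂ] Cc A →ₗ[ℂ] Cc A :=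
  lift fun g => (lift fun h => ((mulₗ A (rfl : g * h = g * h)).compr₂ (j A (g * h))).flip).flip

theorem conv_j {g h k : G} (e : g * h = k) (a : A g) (b : A h) :
    conv (j A g a) (j A h b) = j A k (mul e a b) := by
  subst e
  simp [conv, lift_j]

open scoped Classical in
/-- The involution `f*(h) = f(h⁻¹)*`, determined by `(j g a)* = j g⁻¹ a*`. -/
def convStar : Cc A →+ Cc A :=
  DirectSum.toAddMonoid fun g =>
    (j A g⁻¹).toAddMonoidHom.comp (invₗ A (rfl : g⁻¹ = g⁻¹)).toAddMonoidHom

theorem convStar_j {g k : G} (e : g⁻¹ = k) (a : A g) :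
    convStar (j A g a) = j A k (inv e a) := by
  classical
  subst e
  exact DirectSum.toAddMonoid_of _ g a

instance : NonUnitalRing (Cc A) where
  mul f₁ f₂ := conv f₁ f₂
  left_distrib f₁ f₂ f₃ := map_add (conv f₁) f₂ f₃
  right_distrib f₁ f₂ f₃ := by
    change conv (f₁ + f₂) f₃ = conv f₁ f₃ + conv f₂ f₃
    rw [map_add, LinearMap.add_apply]
  zero_mul f := by
    change conv 0 f = 0
    rw [map_zero, LinearMap.zero_apply]
  mul_zero f := map_zero (conv f)
  mul_assoc f₁ f₂ f₃ := by
    change conv (conv f₁ f₂) f₃ = conv f₁ (conv f₂ f₃)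
    induction f₁ using Cc.induction with
    | h0 => simp
    | hadd _ _ h₁ h₂ => simp only [map_add, LinearMap.add_apply, h₁, h₂]
    | hj g a =>
      induction f₂ using Cc.induction with
      | h0 => simp
      | hadd _ _ h₁ h₂ => simp only [map_add, LinearMap.add_apply, h₁, h₂]
      | hj h b =>
        induction f₃ using Cc.induction with
        | h0 => simp
        | hadd _ _ h₁ h₂ => simp only [map_add, h₁, h₂]
        | hj k c =>
          rw [conv_j rfl, conv_j (_root_.mul_assoc g h k), conv_j rfl, conv_j rfl,
            mul_assoc (A := A)]

theorem j_mul_j {g h k : G} (e : g * h = k) (a : A g) (b : A h) :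
    j A g a * j A h b = j A k (mul e a b) := conv_j e a b

instance : IsScalarTower ℂ (Cc A) (Cc A) where
  smul_assoc z f₁ f₂ := by
    change conv (z • f₁) f₂ = z • conv f₁ f₂
    rw [map_smul, LinearMap.smul_apply]

instance : SMulCommClass ℂ (Cc A) (Cc A) where
  smul_comm z f₁ f₂ := (map_smul (conv f₁) z f₂).symm

instance : StarRing (Cc A) where
  star f := convStar f
  star_involutive f := by
    change convStar (convStar f) = f
    induction f using Cc.induction with
    | h0 => simp
    | hadd _ _ h₁ h₂ => rw [map_add, map_add, h₁, h₂]
    | hj g a => rw [convStar_j rfl, convStar_j (_root_.inv_inv g), inv_inv]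
  star_mul f₁ f₂ := by
    change convStar (conv f₁ f₂) = conv (convStar f₂) (convStar f₁)
    induction f₁ using Cc.induction with
    | h0 => simp
    | hadd _ _ h₁ h₂ => simp only [map_add, LinearMap.add_apply, h₁, h₂]
    | hj g a =>
      induction f₂ using Cc.induction with
      | h0 => simp
      | hadd _ _ h₁ h₂ => simp only [map_add, LinearMap.add_apply, h₁, h₂]
      | hj h b =>
        rw [conv_j rfl, convStar_j rfl, convStar_j rfl, convStar_j rfl,
          conv_j (mul_inv_rev g h).symm, inv_mul]
  star_add := map_add convStar

theorem star_j {g k : G} (e : g⁻¹ = k) (a : A g) : star (j A g a) = j A k (inv e a) :=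
  convStar_j e a

instance : StarModule ℂ (Cc A) where
  star_smul z f := by
    induction f using Cc.induction with
    | h0 => simp
    | hadd _ _ h₁ h₂ => simp only [smul_add, star_add, h₁, h₂]
    | hj g a => rw [← map_smul, star_j rfl, star_j rfl, inv_smul, map_smul]; rfl

/-- `(a f)(g k) = a f(k)` for `a` in `A g`. -/
theorem ev_j_mul {g k l : G} (e : g * k = l) (a : A g) (f : Cc A) :
    ev A l (j A g a * f) = mul e a (ev A k f) := by
  induction f using Cc.induction with
  | h0 => simp
  | hadd _ _ h₁ h₂ => rw [_root_.mul_add, map_add, map_add, h₁, h₂, mul_add]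
  | hj h b =>
    by_cases hk : h = k
    · subst hk
      rw [j_mul_j e, ev_j_same, ev_j_same]
    · rw [j_mul_j rfl, ev_j_ne hk, mul_zero, ev_j_ne]
      rintro rfl
      exact hk (mul_left_cancel e).symm

/-- `(f b)(k h) = f(k) b` for `b` in `A h`. -/
theorem ev_mul_j {k h l : G} (e : k * h = l) (f : Cc A) (b : A h) :
    ev A l (f * j A h b) = mul e (ev A k f) b := by
  induction f using Cc.induction with
  | h0 => simp
  | hadd _ _ h₁ h₂ => rw [_root_.add_mul, map_add, map_add, h₁, h₂, add_mul]
  | hj g a =>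
    by_cases hk : g = k
    · subst hk
      rw [j_mul_j e, ev_j_same, ev_j_same]
    · rw [j_mul_j rfl, ev_j_ne hk, zero_mul, ev_j_ne]
      rintro rfl
      exact hk (mul_right_cancel e).symm

/-- The convolution formula `(f₁ * f₂)(h) = ∑ g, f₁(g) f₂(g⁻¹ h)`. -/
theorem ev_mul (f₁ f₂ : Cc A) (h : G) :
    ev A h (f₁ * f₂) =
      ∑ g ∈ supp f₁, mul (mul_inv_cancel_left g h) (ev A g f₁) (ev A (g⁻¹ * h) f₂) := by
  conv_lhs => rw [eq_sum_j f₁]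
  rw [Finset.sum_mul, map_sum]
  exact Finset.sum_congr rfl fun g _ => ev_j_mul _ _ _

/-- The formula `f*(h) = f(h⁻¹)*`. -/
theorem ev_star (f : Cc A) (h : G) : ev A h (star f) = inv (_root_.inv_inv h) (ev A h⁻¹ f) := by
  induction f using Cc.induction with
  | h0 => simp
  | hadd _ _ h₁ h₂ => rw [star_add, map_add, map_add, h₁, h₂, inv_add]
  | hj g a =>
    by_cases hg : g = h⁻¹
    · subst hg
      rw [star_j (_root_.inv_inv h), ev_j_same, ev_j_same]
    · rw [star_j rfl, ev_j_ne hg, inv_zero, ev_j_ne]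
      rintro rfl
      exact hg (_root_.inv_inv g).symm

/-! ### The Hilbert module `ℓ²` -/

/-- The `A 1`-valued inner product `⟨f₁, f₂⟩ = ∑ h, f₁(h)* f₂(h)` on finitely supported
sections. -/
def ip (f₁ f₂ : Cc A) : UnitFiber A :=
  ∑ h ∈ supp f₁, toUnit A (mul (inv_mul_cancel h) (inv rfl (ev A h f₁)) (ev A h f₂))

theorem ip_eq (f₁ f₂ : Cc A) : ip f₁ f₂ = toUnit A (ev A 1 (star f₁ * f₂)) := by
  conv_rhs => rw [eq_sum_j f₁]
  rw [star_sum, Finset.sum_mul, map_sum, map_sum]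
  refine Finset.sum_congr rfl fun h _ => ?_
  rw [star_j rfl, ev_j_mul (inv_mul_cancel h)]

theorem ip_self_nonneg (f : Cc A) : 0 ≤ ip f f :=
  Finset.sum_nonneg fun _ _ => toUnit_inv_mul_self_nonneg _ _ _

theorem le_ip_self (f : Cc A) (h : G) :
    toUnit A (mul (inv_mul_cancel h) (inv rfl (ev A h f)) (ev A h f)) ≤ ip f f := by
  by_cases hh : h ∈ supp f
  · exact Finset.single_le_sum
      (f := fun h => toUnit A (mul (inv_mul_cancel h) (inv rfl (ev A h f)) (ev A h f)))
      (fun _ _ => toUnit_inv_mul_self_nonneg _ _ _) hh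
  · rw [ev_eq_zero hh, mul_zero, map_zero]
    exact ip_self_nonneg f

theorem norm_ev_sq_le (f : Cc A) (h : G) : ‖ev A h f‖ ^ 2 ≤ ‖ip f f‖ := by
  rw [← norm_inv_mul_self rfl (inv_mul_cancel h), ← norm_toUnit]
  exact CStarAlgebra.norm_le_norm_of_nonneg_of_le (toUnit_inv_mul_self_nonneg _ _ _)
    (le_ip_self f h)

theorem ip_add_right (x y z : Cc A) : ip x (y + z) = ip x y + ip x z := by
  simp only [ip_eq, _root_.mul_add, map_add]

theorem ip_smul_right (c : ℂ) (x y : Cc A) : ip x (c • y) = c • ip x y := by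
  simp only [ip_eq, mul_smul_comm, map_smul]

theorem star_ip (x y : Cc A) : star (ip x y) = ip y x := by
  rw [ip_eq, ip_eq]
  have : star y * x = star (star x * y) := by rw [star_mul, star_star]
  rw [this]
  generalize star x * y = f
  induction f using Cc.induction with
  | h0 => simp
  | hadd _ _ h₁ h₂ => rw [star_add, map_add, map_add, map_add, map_add, star_add, h₁, h₂]
  | hj g a =>
    by_cases hg : g = 1
    · subst hg
      rw [star_j inv_one, ev_j_same, ev_j_same]
      rfl
    · rw [star_j rfl, ev_j_ne hg, ev_j_ne (inv_ne_one.mpr hg)]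
      simp

variable (A) in
/-- The finitely supported sections, with the norm `‖f‖ = ‖⟨f, f⟩‖ ^ (1/2)`. -/
def PreL2 : Type max u v := Cc A

instance : AddCommGroup (PreL2 A) := inferInstanceAs (AddCommGroup (Cc A))

instance : Module ℂ (PreL2 A) := inferInstanceAs (Module ℂ (Cc A))

variable (A) in
/-- The identity map from `Cc A` to `PreL2 A`. -/
def toPre : Cc A ≃ₗ[ℂ] PreL2 A := LinearEquiv.refl ℂ (Cc A)

instance : Norm (PreL2 A) := ⟨fun f => √‖ip ((toPre A).symm f) ((toPre A).symm f)‖⟩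

/-- The right action of the unit fibre, `(f a)(h) = f(h) a`. -/
instance : SMul (UnitFiber A)ᵐᵒᵖ (PreL2 A) :=
  ⟨fun a f => toPre A ((toPre A).symm f * j A 1 (ofUnit A a.unop))⟩

/-- The sections as a right pre-Hilbert module over `A 1`, that is, as a module over the opposite
algebra, with inner product `ip`. -/
instance : CStarModule (UnitFiber A)ᵐᵒᵖ (PreL2 A) where
  inner f₁ f₂ := MulOpposite.op (ip ((toPre A).symm f₁) ((toPre A).symm f₂))
  inner_add_right {x y z} := by
    rw [map_add, ip_add_right, MulOpposite.op_add]
  inner_self_nonneg {x} := ip_self_nonneg (A := A) ((toPre A).symm x)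
  inner_self {x} := by
    constructor
    · intro hx
      rw [MulOpposite.op_eq_zero_iff] at hx
      apply (toPre A).symm.injective
      refine Cc.ext fun g => ?_
      have := norm_ev_sq_le ((toPre A).symm x) g
      rw [hx, norm_zero] at this
      rw [map_zero, map_zero, ← norm_eq_zero]
      exact pow_eq_zero_iff two_ne_zero |>.mp (le_antisymm this (sq_nonneg _))
    · rintro rfl
      simp [ip_eq]
  inner_op_smul_right {a x y} := by
    apply MulOpposite.unop_injective
    change ip _ ((toPre A).symm y * j A 1 (ofUnit A a.unop)) = ip _ _ * a.unop
    rw [ip_eq, ip_eq, ← _root_.mul_assoc, ev_mul_j (_root_.mul_one 1)]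
    rfl
  inner_smul_right_complex {z x y} := by
    rw [map_smul, ip_smul_right, MulOpposite.op_smul]
  star_inner x y := by
    rw [← MulOpposite.op_star, star_ip]
  norm_eq_sqrt_norm_inner_self x := rfl

instance : NormedAddCommGroup (PreL2 A) :=
  NormedAddCommGroup.ofCore (CStarModule.normedSpaceCore (UnitFiber A)ᵐᵒᵖ)

instance : NormedSpace ℂ (PreL2 A) :=
  NormedSpace.ofCore (CStarModule.normedSpaceCore (UnitFiber A)ᵐᵒᵖ)

theorem norm_toPre_sq (f : Cc A) : ‖toPre A f‖ ^ 2 = ‖ip f f‖ :=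
  Real.sq_sqrt (norm_nonneg _)

theorem norm_ip_le (f₁ f₂ : Cc A) : ‖ip f₁ f₂‖ ≤ ‖toPre A f₁‖ * ‖toPre A f₂‖ :=
  CStarModule.norm_inner_le (A := (UnitFiber A)ᵐᵒᵖ) (PreL2 A) (x := toPre A f₁) (y := toPre A f₂)

theorem norm_ev_le (f : Cc A) (h : G) : ‖ev A h f‖ ≤ ‖toPre A f‖ := by
  refine le_of_sq_le_sq ?_ (norm_nonneg _)
  rw [norm_toPre_sq]
  exact norm_ev_sq_le f h

open UniformSpace (Completion)

variable (A) in
/-- The right Hilbert `A 1`-module `ℓ²(A)`: the completion of the finitely supported sections. -/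
def L2 : Type max u v := Completion (PreL2 A)

instance : NormedAddCommGroup (L2 A) := inferInstanceAs (NormedAddCommGroup (Completion (PreL2 A)))

instance : NormedSpace ℂ (L2 A) := inferInstanceAs (NormedSpace ℂ (Completion (PreL2 A)))

instance : CompleteSpace (L2 A) := inferInstanceAs (CompleteSpace (Completion (PreL2 A)))

variable (A) in
/-- The canonical map from finitely supported sections to `ℓ²(A)`. -/
def toL2 : Cc A →ₗ[ℂ] L2 A :=
  (UniformSpace.Completion.toComplₗᵢ (𝕜 := ℂ) (E := PreL2 A)).toLinearMap ∘ₗ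
    (toPre A).toLinearMap

theorem norm_toL2 (f : Cc A) : ‖toL2 A f‖ = ‖toPre A f‖ :=
  UniformSpace.Completion.norm_coe (toPre A f)

theorem denseRange_toL2 : DenseRange (toL2 A) :=
  UniformSpace.Completion.denseRange_coe (α := PreL2 A)

theorem norm_toL2_sq (f : Cc A) : ‖toL2 A f‖ ^ 2 = ‖ip f f‖ := by
  rw [norm_toL2, norm_toPre_sq]

theorem ip_add_left (x y z : Cc A) : ip (x + y) z = ip x z + ip y z := by
  rw [← star_ip, ip_add_right, star_add, star_ip, star_ip]

/-- The inner product as a biadditive map. -/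
def ipHom : PreL2 A →+ PreL2 A →+ UnitFiber A :=
  AddMonoidHom.mk' (fun x => AddMonoidHom.mk'
    (fun y => ip ((toPre A).symm x) ((toPre A).symm y))
    (fun y z => by rw [map_add, ip_add_right]))
    (fun x y => by
      ext z
      change ip ((toPre A).symm (x + y)) _ = ip _ _ + ip _ _
      rw [map_add, ip_add_left])

theorem continuous_ipHom : Continuous fun p : PreL2 A × PreL2 A => ipHom p.1 p.2 :=
  MulOpposite.continuous_unop.comp
    (CStarModule.continuous_inner (A := (UnitFiber A)ᵐᵒᵖ) (E := PreL2 A))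

/-- The `A 1`-valued inner product of `ℓ²(A)`, the continuous extension of `ip`. -/
def ipL2 (x y : L2 A) : UnitFiber A :=
  ((UniformSpace.Completion.isDenseInducing_coe (α := PreL2 A)).prodMap
    (UniformSpace.Completion.isDenseInducing_coe (α := PreL2 A))).extend
    (fun p : PreL2 A × PreL2 A => ipHom p.1 p.2) (x, y)

theorem ipL2_toL2 (f₁ f₂ : Cc A) : ipL2 (toL2 A f₁) (toL2 A f₂) = ip f₁ f₂ :=
  ((UniformSpace.Completion.isDenseInducing_coe (α := PreL2 A)).prodMap
    (UniformSpace.Completion.isDenseInducing_coe (α := PreL2 A))).extend_eq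
      continuous_ipHom (toPre A f₁, toPre A f₂)

theorem continuous_ipL2' : Continuous fun p : L2 A × L2 A => ipL2 p.1 p.2 :=
  (UniformSpace.Completion.isDenseInducing_toCompl (PreL2 A)).extend_Z_bilin
    (UniformSpace.Completion.isDenseInducing_toCompl (PreL2 A)) continuous_ipHom

@[fun_prop]
theorem continuous_ipL2 {X : Type*} [TopologicalSpace X] {f g : X → L2 A} (hf : Continuous f)
    (hg : Continuous g) : Continuous fun x => ipL2 (f x) (g x) :=
  continuous_ipL2'.comp (hf.prodMk hg)

theorem L2.induction {p : L2 A → Prop} (x : L2 A) (hp : IsClosed {x | p x})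
    (h : ∀ f, p (toL2 A f)) : p x :=
  UniformSpace.Completion.induction_on x hp fun f => h ((toPre A).symm f)

theorem ipL2_add_right (x y z : L2 A) : ipL2 x (y + z) = ipL2 x y + ipL2 x z := by
  induction x using L2.induction with
  | hp => exact isClosed_eq (by fun_prop) (by fun_prop)
  | h x =>
    induction y using L2.induction with
    | hp => exact isClosed_eq (by fun_prop) (by fun_prop)
    | h y =>
      induction z using L2.induction with
      | hp => exact isClosed_eq (by fun_prop) (by fun_prop)
      | h z => rw [← map_add, ipL2_toL2, ipL2_toL2, ipL2_toL2, ip_add_right]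

theorem ipL2_smul_right (c : ℂ) (x y : L2 A) : ipL2 x (c • y) = c • ipL2 x y := by
  induction x using L2.induction with
  | hp => exact isClosed_eq (by fun_prop) (by fun_prop)
  | h x =>
    induction y using L2.induction with
    | hp =>
      exact isClosed_eq (continuous_ipL2 continuous_const (continuous_const_smul c))
        ((continuous_ipL2 continuous_const continuous_id).const_smul c)
    | h y => rw [← map_smul, ipL2_toL2, ipL2_toL2, ip_smul_right]

theorem star_ipL2 (x y : L2 A) : star (ipL2 x y) = ipL2 y x := by
  induction x using L2.induction with
  | hp => exact isClosed_eq (by fun_prop) (by fun_prop)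
  | h x =>
    induction y using L2.induction with
    | hp => exact isClosed_eq (by fun_prop) (by fun_prop)
    | h y => rw [ipL2_toL2, ipL2_toL2, star_ip]

theorem norm_ipL2_self (x : L2 A) : ‖ipL2 x x‖ = ‖x‖ ^ 2 := by
  induction x using L2.induction with
  | hp => exact isClosed_eq (by fun_prop) (by fun_prop)
  | h x => rw [ipL2_toL2, norm_toL2_sq]

theorem norm_ipL2_le (x y : L2 A) : ‖ipL2 x y‖ ≤ ‖x‖ * ‖y‖ := by
  induction x using L2.induction with
  | hp => exact isClosed_le (by fun_prop) (by fun_prop)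
  | h x =>
    induction y using L2.induction with
    | hp => exact isClosed_le (by fun_prop) (by fun_prop)
    | h y => rw [ipL2_toL2, norm_toL2, norm_toL2]; exact norm_ip_le x y

theorem ipL2_add_left (x y z : L2 A) : ipL2 (x + y) z = ipL2 x z + ipL2 y z := by
  rw [← star_ipL2, ipL2_add_right, star_add, star_ipL2, star_ipL2]

theorem ipL2_smul_left (c : ℂ) (x y : L2 A) : ipL2 (c • x) y = star c • ipL2 x y := by
  rw [← star_ipL2, ipL2_smul_right, star_smul, star_ipL2]

theorem ipL2_ext {x y : L2 A} (H : ∀ z, ipL2 z x = ipL2 z y) : x = y := by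
  have h1 : ∀ z, ipL2 z (x - y) = 0 := fun z => by
    have h2 := ipL2_add_right z (x - y) y
    rw [sub_add_cancel, H z] at h2
    exact right_eq_add.mp h2
  have h3 := norm_ipL2_self (x - y)
  rw [h1, norm_zero] at h3
  exact sub_eq_zero.mp (norm_eq_zero.mp (pow_eq_zero_iff two_ne_zero |>.mp h3.symm))

/-! ### Adjointable operators -/

variable (A) in
/-- `S` is an adjoint of `T`. -/
def IsAdj (T S : L2 A →L[ℂ] L2 A) : Prop := ∀ x y, ipL2 (T x) y = ipL2 x (S y)

theorem IsAdj.symm {T S : L2 A →L[ℂ] L2 A} (h : IsAdj A T S) : IsAdj A S T := fun x y => by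
  rw [← star_ipL2, ← h, star_ipL2]

theorem IsAdj.unique {T S S' : L2 A →L[ℂ] L2 A} (h : IsAdj A T S) (h' : IsAdj A T S') :
    S = S' := by
  ext1 y
  exact ipL2_ext fun z => by rw [← h, ← h']

theorem IsAdj.add {T S T' S' : L2 A →L[ℂ] L2 A} (h : IsAdj A T S) (h' : IsAdj A T' S') :
    IsAdj A (T + T') (S + S') := fun x y => by
  rw [add_apply, add_apply, ipL2_add_left,
    ipL2_add_right, h, h']

theorem IsAdj.smul {T S : L2 A →L[ℂ] L2 A} (c : ℂ) (h : IsAdj A T S) :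
    IsAdj A (c • T) (star c • S) := fun x y => by
  rw [smul_apply, smul_apply, ipL2_smul_left,
    ipL2_smul_right, h]

theorem IsAdj.mul {T S T' S' : L2 A →L[ℂ] L2 A} (h : IsAdj A T S) (h' : IsAdj A T' S') :
    IsAdj A (T * T') (S' * S) := fun x y => by
  rw [mul_apply_eq_comp, mul_apply_eq_comp, h, h']

theorem IsAdj.norm_sq_le {T S : L2 A →L[ℂ] L2 A} (h : IsAdj A T S) :
    ‖T‖ * ‖T‖ ≤ ‖S * T‖ := by
  have h1 : ‖T‖ ≤ √‖S * T‖ := by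
    refine T.opNorm_le_bound (Real.sqrt_nonneg _) fun x => ?_
    refine le_of_sq_le_sq ?_ (by positivity)
    rw [mul_pow, Real.sq_sqrt (norm_nonneg _), ← norm_ipL2_self, h, ← mul_apply_eq_comp]
    calc _ ≤ ‖x‖ * ‖(S * T) x‖ := norm_ipL2_le _ _
      _ ≤ ‖x‖ * (‖S * T‖ * ‖x‖) := by gcongr; exact (S * T).le_opNorm x
      _ = _ := by ring
  calc _ ≤ √‖S * T‖ * √‖S * T‖ := by gcongr
    _ = _ := Real.mul_self_sqrt (norm_nonneg _)

theorem IsAdj.norm_le {T S : L2 A →L[ℂ] L2 A} (h : IsAdj A T S) : ‖T‖ ≤ ‖S‖ := by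
  rcases (norm_nonneg T).eq_or_lt with h0 | h0
  · rw [← h0]; exact norm_nonneg S
  · exact le_of_mul_le_mul_right (h.norm_sq_le.trans (_root_.norm_mul_le S T)) h0

theorem IsAdj.norm_eq {T S : L2 A →L[ℂ] L2 A} (h : IsAdj A T S) : ‖S‖ = ‖T‖ :=
  le_antisymm h.symm.norm_le h.norm_le

theorem IsAdj.one : IsAdj A 1 1 := fun _ _ => rfl

variable (A) in
/-- The algebra of adjointable operators on `ℓ²(A)`: the operators that have an adjoint for the
`A 1`-valued inner product (such operators are automatically right `A 1`-linear). -/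
def adjointable : Subalgebra ℂ (L2 A →L[ℂ] L2 A) where
  carrier := {T | ∃ S, IsAdj A T S}
  mul_mem' := fun ⟨_, h⟩ ⟨_, h'⟩ => ⟨_, h.mul h'⟩
  add_mem' := fun ⟨_, h⟩ ⟨_, h'⟩ => ⟨_, h.add h'⟩
  algebraMap_mem' c := ⟨_, by
    rw [Algebra.algebraMap_eq_smul_one]
    exact IsAdj.one.smul c⟩

variable (A) in
/-- The C*-algebra of adjointable operators on `ℓ²(A)`. -/
def Adjointable : Type max u v := adjointable A

instance : NormedRing (Adjointable A) := inferInstanceAs (NormedRing (adjointable A))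

instance : NormedAlgebra ℂ (Adjointable A) := inferInstanceAs (NormedAlgebra ℂ (adjointable A))

/-- The underlying operator. -/
def Adjointable.op (T : Adjointable A) : L2 A →L[ℂ] L2 A := T.1

/-- The operator underlying the adjoint. -/
def Adjointable.adj (T : Adjointable A) : L2 A →L[ℂ] L2 A := T.2.choose

theorem Adjointable.isAdj (T : Adjointable A) : IsAdj A T.op T.adj := T.2.choose_spec

theorem Adjointable.op_injective : Function.Injective (Adjointable.op (A := A)) :=
  Subtype.val_injective

theorem Adjointable.op_add (T S : Adjointable A) : (T + S).op = T.op + S.op := rfl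

theorem Adjointable.op_mul (T S : Adjointable A) : (T * S).op = T.op * S.op := rfl

theorem Adjointable.op_smul (c : ℂ) (T : Adjointable A) : (c • T).op = c • T.op := rfl

theorem Adjointable.norm_op (T : Adjointable A) : ‖T.op‖ = ‖T‖ := rfl

/-- The involution is the adjoint. -/
instance : Star (Adjointable A) := ⟨fun T => ⟨T.adj, T.op, T.isAdj.symm⟩⟩

theorem Adjointable.op_star (T : Adjointable A) : (star T).op = T.adj := rfl

theorem Adjointable.star_eq {T S : Adjointable A} (h : IsAdj A T.op S.op) : star T = S :=
  Adjointable.op_injective (T.isAdj.unique h)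

instance : StarRing (Adjointable A) where
  star_involutive T := Adjointable.star_eq T.isAdj.symm
  star_mul T S := Adjointable.star_eq (T.isAdj.mul S.isAdj)
  star_add T S := Adjointable.star_eq (T.isAdj.add S.isAdj)

instance : StarModule ℂ (Adjointable A) where
  star_smul c T := Adjointable.star_eq (T.isAdj.smul c)

theorem Adjointable.isClosed_adjointable :
    IsClosed (adjointable A : Set (L2 A →L[ℂ] L2 A)) := by
  refine isClosed_of_closure_subset fun T hT => ?_
  obtain ⟨t, ht, hlim⟩ := mem_closure_iff_seq_limit.mp hT
  choose s hs using ht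
  have hc : CauchySeq s := by
    refine Metric.cauchySeq_iff.mpr fun ε hε => ?_
    obtain ⟨N, hN⟩ := Metric.cauchySeq_iff.mp hlim.cauchySeq ε hε
    refine ⟨N, fun m hm n hn => ?_⟩
    have h1 := ((hs m).add ((hs n).smul (-1))).norm_eq
    simp only [star_neg, star_one, neg_smul, one_smul, ← sub_eq_add_neg] at h1
    rw [dist_eq_norm, h1, ← dist_eq_norm]
    exact hN m hm n hn
  obtain ⟨S, hS⟩ := cauchySeq_tendsto_of_complete hc
  refine ⟨S, fun x y => ?_⟩
  have h1 : Filter.Tendsto (fun n => t n x) Filter.atTop (nhds (T x)) :=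
    ((ContinuousLinearMap.apply ℂ (L2 A) x).continuous.tendsto T).comp hlim
  have h2 : Filter.Tendsto (fun n => s n y) Filter.atTop (nhds (S y)) :=
    ((ContinuousLinearMap.apply ℂ (L2 A) y).continuous.tendsto S).comp hS
  have h3 := ((continuous_ipL2 continuous_id (continuous_const (y := y))).tendsto (T x)).comp h1
  have h4 := ((continuous_ipL2 (continuous_const (y := x)) continuous_id).tendsto (S y)).comp h2
  refine tendsto_nhds_unique h3 (h4.congr fun n => ?_)
  exact (hs n x y).symm

instance : CStarAlgebra (Adjointable A) where
  toCompleteSpace := Adjointable.isClosed_adjointable.completeSpace_coe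
  norm_mul_self_le T := T.isAdj.norm_sq_le

/-! ### The regular representation and the reduced cross-sectional C*-algebra -/

theorem ip_mul_left (f x y : Cc A) : ip (f * x) y = ip x (star f * y) := by
  rw [ip_eq, ip_eq, star_mul, _root_.mul_assoc]

theorem ip_j_mul_le (g : G) (a : A g) (x : Cc A) :
    ip (j A g a * x) (j A g a * x) ≤ ((‖a‖ ^ 2 : ℝ) : ℂ) • ip x x := by
  have e' : g⁻¹ * g = 1 := inv_mul_cancel g
  rw [ip_mul_left, ← _root_.mul_assoc, star_j rfl, j_mul_j e', ip, ip, Finset.smul_sum]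
  refine Finset.sum_le_sum fun h _ => ?_
  rw [ev_j_mul (_root_.one_mul h)]
  refine conj_le rfl (inv_mul_cancel h) (toUnit A (mul e' (inv rfl a) a))
    (toUnit_inv_mul_self_nonneg _ _ _) _ ?_ _
  rw [norm_toUnit, norm_inv_mul_self]

theorem norm_j_mul_le (g : G) (a : A g) (x : Cc A) :
    ‖toL2 A (j A g a * x)‖ ≤ ‖a‖ * ‖toL2 A x‖ := by
  refine le_of_sq_le_sq ?_ (by positivity)
  rw [mul_pow, norm_toL2_sq, norm_toL2_sq]
  refine (CStarAlgebra.norm_le_norm_of_nonneg_of_le (ip_self_nonneg _) (ip_j_mul_le g a x)).trans ?_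
  rw [norm_smul, Complex.norm_real, Real.norm_of_nonneg (sq_nonneg _)]

theorem exists_norm_mul_le (f : Cc A) : ∃ C, ∀ x, ‖toL2 A (f * x)‖ ≤ C * ‖toL2 A x‖ := by
  induction f using Cc.induction with
  | h0 => exact ⟨0, fun x => by simp⟩
  | hj g a => exact ⟨‖a‖, norm_j_mul_le g a⟩
  | hadd f₁ f₂ h₁ h₂ =>
    obtain ⟨C₁, h₁⟩ := h₁
    obtain ⟨C₂, h₂⟩ := h₂
    refine ⟨C₁ + C₂, fun x => ?_⟩
    rw [_root_.add_mul, map_add, _root_.add_mul]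
    exact (norm_add_le _ _).trans (add_le_add (h₁ x) (h₂ x))

/-- The operator on `ℓ²(A)` extending the left convolution by a finitely supported section. -/
def convOp (f : Cc A) : L2 A →L[ℂ] L2 A := (toL2 A ∘ₗ conv f).extendOfNorm (toL2 A)

theorem convOp_toL2 (f x : Cc A) : convOp f (toL2 A x) = toL2 A (f * x) :=
  LinearMap.extendOfNorm_eq denseRange_toL2 (exists_norm_mul_le f) x

theorem convOp_eq {f : Cc A} {T : L2 A →L[ℂ] L2 A} (H : ∀ x, T (toL2 A x) = toL2 A (f * x)) :
    convOp f = T := by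
  ext1 x
  induction x using L2.induction with
  | hp => exact isClosed_eq (by fun_prop) (by fun_prop)
  | h x => rw [convOp_toL2, H]

theorem convOp_isAdj (f : Cc A) : IsAdj A (convOp f) (convOp (star f)) := fun x y => by
  induction x using L2.induction with
  | hp => exact isClosed_eq (by fun_prop) (by fun_prop)
  | h x =>
    induction y using L2.induction with
    | hp => exact isClosed_eq (by fun_prop) (by fun_prop)
    | h y => rw [convOp_toL2, convOp_toL2, ipL2_toL2, ipL2_toL2, ip_mul_left]

/-- The operator `convOp f` as an adjointable operator. -/
def convAdj (f : Cc A) : Adjointable A := ⟨convOp f, convOp (star f), convOp_isAdj f⟩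

theorem op_convAdj (f : Cc A) : (convAdj f).op = convOp f := rfl

variable (A) in
/-- The regular representation of the `*`-algebra of finitely supported sections on `ℓ²(A)`,
by left convolution. -/
def iota : Cc A →⋆ₙₐ[ℂ] Adjointable A where
  toFun := convAdj
  map_smul' c f := Adjointable.op_injective <| convOp_eq fun x => by
    rw [MonoidHom.id_apply, Adjointable.op_smul, smul_apply, op_convAdj, convOp_toL2,
      smul_mul_assoc, map_smul]
  map_zero' := Adjointable.op_injective <| convOp_eq fun x => by
    rw [MulZeroClass.zero_mul, map_zero]
    rfl
  map_add' f₁ f₂ := Adjointable.op_injective <| convOp_eq fun x => by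
    rw [Adjointable.op_add, add_apply, op_convAdj, op_convAdj, convOp_toL2, convOp_toL2,
      _root_.add_mul, map_add]
  map_mul' f₁ f₂ := Adjointable.op_injective <| convOp_eq fun x => by
    rw [Adjointable.op_mul, mul_apply_eq_comp, op_convAdj, op_convAdj, convOp_toL2, convOp_toL2,
      _root_.mul_assoc]
  map_star' f := by
    refine (Adjointable.star_eq ?_).symm
    rw [op_convAdj, op_convAdj]
    exact convOp_isAdj f

theorem op_iota_toL2 (f x : Cc A) : (iota A f).op (toL2 A x) = toL2 A (f * x) := convOp_toL2 f x

variable (A) in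
/-- The reduced cross-sectional C*-algebra, as a closed `*`-subalgebra of the adjointable operators
on `ℓ²(A)`. -/
def reducedSubalgebra : NonUnitalStarSubalgebra ℂ (Adjointable A) :=
  (NonUnitalStarAlgHom.range (iota A)).topologicalClosure

variable (A) in
/-- The reduced cross-sectional C*-algebra of the Fell bundle. -/
def Reduced : Type max u v := reducedSubalgebra A

instance : NonUnitalCStarAlgebra (Reduced A) :=
  NonUnitalStarSubalgebra.nonUnitalCStarAlgebra (reducedSubalgebra A)
    (h_closed := 
      NonUnitalStarSubalgebra.isClosed_topologicalClosure (NonUnitalStarAlgHom.range (iota A)))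

/-- The usual order of a C*-algebra. -/
instance : PartialOrder (Reduced A) := CStarAlgebra.spectralOrder _

instance : StarOrderedRing (Reduced A) := CStarAlgebra.spectralOrderedRing _

variable (A) in
/-- The regular representation with values in the reduced cross-sectional C*-algebra. -/
def toReduced : Cc A →⋆ₙₐ[ℂ] Reduced A :=
  NonUnitalStarAlgHom.codRestrict (iota A) (reducedSubalgebra A) fun f =>
    NonUnitalStarSubalgebra.le_topologicalClosure _ ⟨f, rfl⟩

theorem norm_toReduced (f : Cc A) : ‖toReduced A f‖ = ‖iota A f‖ := rfl

theorem denseRange_toReduced : DenseRange (toReduced A) := by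
  have key : DenseRange (NonUnitalStarAlgHom.codRestrict (iota A) (reducedSubalgebra A) fun f =>
      NonUnitalStarSubalgebra.le_topologicalClosure _ ⟨f, rfl⟩) := by
    refine Subtype.dense_iff.mpr fun x hx => ?_
    rw [← Set.range_comp]
    exact hx
  exact key

variable (A) in
/-- The regular representation `λ` of the fibre `A g`: the operator `λ g a` on `ℓ²(A)` satisfies
`(λ g a f)(h) = a f(g⁻¹ h)` for finitely supported `f`. -/
def lam (g : G) : A g →ₗ[ℂ] Reduced A := (toReduced A : Cc A →ₗ[ℂ] Reduced A) ∘ₗ j A g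

theorem norm_toL2_j (g : G) (a : A g) : ‖toL2 A (j A g a)‖ = ‖a‖ := by
  rw [← sq_eq_sq₀ (norm_nonneg _) (norm_nonneg _), norm_toL2_sq, ip_eq, star_j rfl,
    j_mul_j (inv_mul_cancel g), ev_j_same, norm_toUnit, norm_inv_mul_self]

theorem norm_ev_le_norm_toReduced (g : G) (f : Cc A) : ‖ev A g f‖ ≤ ‖toReduced A f‖ := by
  rw [norm_toReduced]
  set a := ev A g f with ha
  have hbd : ∀ c : A 1, ‖mul (_root_.mul_one g) a c‖ ≤ ‖iota A f‖ * ‖c‖ := fun c => by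
    rw [ha, ← ev_mul_j (_root_.mul_one g)]
    refine (norm_ev_le _ _).trans ?_
    rw [← norm_toL2, ← op_iota_toL2, ← norm_toL2_j 1 c, ← Adjointable.norm_op]
    exact ContinuousLinearMap.le_opNorm _ _
  have e' : g⁻¹ * g = 1 := inv_mul_cancel g
  set c : A 1 := mul e' (inv rfl a) a with hc
  have hcn : ‖c‖ = ‖a‖ ^ 2 := norm_inv_mul_self _ _ _
  have hsa : inv inv_one c = c := by
    rw [hc, inv_mul e' inv_one (_root_.inv_inv g) rfl e', inv_inv]
  have h1 : ‖c‖ ^ 2 ≤ ‖a‖ * (‖iota A f‖ * ‖c‖) := by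
    rw [← norm_inv_mul_self inv_one (_root_.mul_one 1) c, hsa]
    have : mul (_root_.mul_one 1) c c = mul e' (inv rfl a) (mul (_root_.mul_one g) a c) :=
      mul_assoc _ _ _ _ _ _ _
    rw [this]
    refine (norm_mul_le _ _ _).trans ?_
    rw [norm_inv]
    gcongr
    exact hbd c
  rcases (norm_nonneg a).eq_or_lt with h0 | h0
  · rw [← h0]; exact norm_nonneg _
  · rw [hcn] at h1
    refine le_of_mul_le_mul_left ?_ (pow_pos h0 3)
    linarith [h1]

variable (A) in
/-- The Fourier coefficient at `g`: the contractive linear map `E g` from the reduced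
cross-sectional C*-algebra to `A g` with `E g (λ g a) = a` and `E g (λ h a) = 0` for `h ≠ g`, the
continuous extension of `f ↦ f(g)`. -/
def E (g : G) : Reduced A →L[ℂ] A g :=
  (ev A g).extendOfNorm (toReduced A : Cc A →ₗ[ℂ] Reduced A)

theorem E_toReduced (g : G) (f : Cc A) : E A g (toReduced A f) = ev A g f :=
  LinearMap.extendOfNorm_eq (e := (toReduced A : Cc A →ₗ[ℂ] Reduced A)) denseRange_toReduced
    ⟨1, fun x => by rw [_root_.one_mul]; exact norm_ev_le_norm_toReduced g x⟩ f

theorem norm_E_le (g : G) (x : Reduced A) : ‖E A g x‖ ≤ ‖x‖ := by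
  have := LinearMap.norm_extendOfNorm_apply_le (f := ev A g)
    (e := (toReduced A : Cc A →ₗ[ℂ] Reduced A)) denseRange_toReduced 1
    (fun x => by rw [_root_.one_mul]; exact norm_ev_le_norm_toReduced g x) x
  rwa [_root_.one_mul] at this

theorem E_lam_same (g : G) (a : A g) : E A g (lam A g a) = a :=
  (E_toReduced g (j A g a)).trans (ev_j_same g a)

theorem E_lam_ne {g h : G} (hgh : h ≠ g) (a : A h) : E A g (lam A h a) = 0 :=
  (E_toReduced g (j A h a)).trans (ev_j_ne hgh a)

/-! ### The full cross-sectional C*-algebra -/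

variable (A) in
/-- The inclusion of the unit fibre in the finitely supported sections. -/
def jUnit : UnitFiber A →⋆ₙₐ[ℂ] Cc A where
  toFun a := j A 1 (ofUnit A a)
  map_smul' c a := by rw [map_smul, map_smul]; rfl
  map_zero' := by rw [map_zero, map_zero]
  map_add' a b := by rw [map_add, map_add]
  map_mul' a b := by rw [j_mul_j (_root_.mul_one 1), ofUnit_mul]
  map_star' a := by rw [star_j inv_one, ofUnit_star]

theorem seminorm_j_le (p : CStarSeminorm (Cc A)) (g : G) (a : A g) :
    p.toSeminorm (j A g a) ≤ ‖a‖ := by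
  refine le_of_sq_le_sq ?_ (norm_nonneg _)
  have h1 : p.toSeminorm (star (j A g a) * j A g a) = p.toSeminorm (j A g a) ^ 2 :=
    p.star_mul_self' _
  rw [← h1, star_j rfl, j_mul_j (inv_mul_cancel g), ← norm_inv_mul_self rfl (inv_mul_cancel g)]
  exact (p.comap (jUnit A)).le_norm (toUnit A (mul (inv_mul_cancel g) (inv rfl a) a))

theorem seminorm_le (p : CStarSeminorm (Cc A)) (f : Cc A) :
    p.toSeminorm f ≤ ∑ g ∈ supp f, ‖ev A g f‖ := by
  conv_lhs => rw [eq_sum_j f]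
  exact (Finset.le_sum_of_subadditive p.toSeminorm (map_zero _).le (map_add_le_add _) _ _).trans
    (Finset.sum_le_sum fun g _ => seminorm_j_le p g _)

theorem bddAbove_seminorm (f : Cc A) :
    BddAbove (Set.range fun p : CStarSeminorm (Cc A) => p.toSeminorm f) :=
  ⟨_, by rintro _ ⟨p, rfl⟩; exact seminorm_le p f⟩

variable (A) in
/-- The C*-seminorm of the regular representation. -/
def redSeminorm : CStarSeminorm (Cc A) := (CStarSeminorm.ofNorm (Reduced A)).comap (toReduced A)

instance : Nonempty (CStarSeminorm (Cc A)) := ⟨redSeminorm A⟩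

variable (A) in
/-- The value at `f` of the universal C*-norm: the supremum of all C*-seminorms. -/
def univNorm (f : Cc A) : ℝ := ⨆ p : CStarSeminorm (Cc A), p.toSeminorm f

theorem le_univNorm (p : CStarSeminorm (Cc A)) (f : Cc A) : p.toSeminorm f ≤ univNorm A f :=
  le_ciSup (bddAbove_seminorm f) p

theorem univNorm_nonneg (f : Cc A) : 0 ≤ univNorm A f :=
  (apply_nonneg (redSeminorm A).toSeminorm f).trans (le_univNorm _ f)

variable (A) in
/-- The universal C*-norm on the finitely supported sections. -/
def univ : CStarSeminorm (Cc A) where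
  toSeminorm := Seminorm.of (univNorm A)
    (fun f₁ f₂ => ciSup_le fun p => (map_add_le_add p.toSeminorm f₁ f₂).trans
      (add_le_add (le_univNorm p f₁) (le_univNorm p f₂)))
    (fun z f => by
      rw [univNorm, univNorm, Real.mul_iSup_of_nonneg (norm_nonneg z)]
      exact iSup_congr fun p => map_smul_eq_mul p.toSeminorm z f)
  mul_le' f₁ f₂ := ciSup_le fun p => (p.mul_le' f₁ f₂).trans
    (mul_le_mul (le_univNorm p f₁) (le_univNorm p f₂) (apply_nonneg p.toSeminorm _)
      (univNorm_nonneg f₁))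
  star_eq' f := iSup_congr fun p => p.star_eq' f
  star_mul_self' f := by
    change univNorm A (star f * f) = univNorm A f ^ 2
    have hp : ∀ p : CStarSeminorm (Cc A), p.toSeminorm (star f * f) = p.toSeminorm f ^ 2 :=
      fun p => p.star_mul_self' f
    refine le_antisymm (ciSup_le fun p => ?_) ?_
    · rw [hp]
      exact pow_le_pow_left₀ (apply_nonneg p.toSeminorm f) (le_univNorm p f) 2
    · refine (Real.le_sqrt (univNorm_nonneg _) (univNorm_nonneg _)).mp (ciSup_le fun p => ?_)
      refine Real.le_sqrt_of_sq_le ?_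
      rw [← hp]
      exact le_univNorm p _

variable (A) in
/-- The full cross-sectional C*-algebra: the completion of the finitely supported sections for the
universal C*-norm. -/
def Full : Type max u v := (univ A).Compl

instance : NonUnitalCStarAlgebra (Full A) := inferInstanceAs (NonUnitalCStarAlgebra (univ A).Compl)

/-- The usual order of a C*-algebra. -/
instance : PartialOrder (Full A) := CStarAlgebra.spectralOrder _

instance : StarOrderedRing (Full A) := CStarAlgebra.spectralOrderedRing _

variable (A) in
/-- The canonical map from the finitely supported sections to the full C*-algebra. -/
def kappa : Cc A →⋆ₙₐ[ℂ] Full A := (univ A).toCompl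

theorem norm_kappa (f : Cc A) : ‖kappa A f‖ = univNorm A f := (univ A).norm_toCompl f

theorem denseRange_kappa : DenseRange (kappa A) := (univ A).denseRange_toCompl

variable (A) in
/-- The canonical map from the fibre `A g` to the full C*-algebra. -/
def jHat (g : G) : A g →ₗ[ℂ] Full A := (kappa A : Cc A →ₗ[ℂ] Full A) ∘ₗ j A g

variable (A) in
/-- The continuous linear map extending `kappa f ↦ toReduced f`. -/
def LambdaL : Full A →L[ℂ] Reduced A :=
  (toReduced A : Cc A →ₗ[ℂ] Reduced A).extendOfNorm (kappa A : Cc A →ₗ[ℂ] Full A)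

theorem LambdaL_kappa (f : Cc A) : LambdaL A (kappa A f) = toReduced A f :=
  LinearMap.extendOfNorm_eq (f := (toReduced A : Cc A →ₗ[ℂ] Reduced A))
    (e := (kappa A : Cc A →ₗ[ℂ] Full A)) denseRange_kappa
    ⟨1, fun x => by
      rw [_root_.one_mul]
      exact (le_univNorm (redSeminorm A) x).trans_eq (norm_kappa x).symm⟩ f

theorem Full.induction {P : Full A → Prop} (x : Full A) (hp : IsClosed {x | P x})
    (h : ∀ f, P (kappa A f)) : P x := denseRange_kappa.induction_on x hp h

variable (A) in
/-- The canonical `*`-homomorphism from the full to the reduced cross-sectional C*-algebra. -/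
def Lambda : Full A →⋆ₙₐ[ℂ] Reduced A where
  toFun := LambdaL A
  map_smul' := map_smul (LambdaL A)
  map_zero' := map_zero (LambdaL A)
  map_add' := map_add (LambdaL A)
  map_mul' x y := by
    induction x using Full.induction with
    | hp => exact isClosed_eq (by fun_prop) (by fun_prop)
    | h x =>
      induction y using Full.induction with
      | hp => exact isClosed_eq (by fun_prop) (by fun_prop)
      | h y => rw [← map_mul, LambdaL_kappa, LambdaL_kappa, LambdaL_kappa, map_mul]
  map_star' x := by
    induction x using Full.induction with
    | hp => exact isClosed_eq (by fun_prop) (by fun_prop)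
    | h x => rw [← map_star, LambdaL_kappa, LambdaL_kappa, map_star]

theorem Lambda_jHat (g : G) (a : A g) : Lambda A (jHat A g a) = lam A g a := LambdaL_kappa _

/-! ### Bundle maps -/

variable {H : Type w} [Group H]

variable (A) in
/-- Bundle maps from `A` to `B` along a group homomorphism `φ`: families of bounded linear maps
`T g : A g → B (φ g)`. -/
abbrev BundleMap (φ : G →* H) (B : H → Type x) [∀ h, NormedAddCommGroup (B h)]
    [∀ h, NormedSpace ℂ (B h)] : Type max u v x :=
  ∀ g : G, A g →L[ℂ] B (φ g)

/-- A bundle map `T` is positive definite if `∑ i j, b i * T (a i* * a j) * (b j)*` is a positive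
element of the C*-algebra `B 1`, for all finite families `g i` in `G`, `a i` in `A (g i)` and `b i`
in `B (φ (g i))`. -/
def BundleMap.IsPositiveDefinite {φ : G →* H} {B : H → Type x} [∀ h, NormedAddCommGroup (B h)]
    [∀ h, NormedSpace ℂ (B h)] [∀ h, CompleteSpace (B h)] [FellBundle B]
    (T : BundleMap A φ B) : Prop :=
  ∀ (n : ℕ) (g : Fin n → G) (a : ∀ i, A (g i)) (b : ∀ i, B (φ (g i))),
    0 ≤ ∑ i, ∑ j, toUnit B
      (mul (mul_inv_cancel (φ (g j)))
        (mul (show φ (g i) * φ ((g i)⁻¹ * g j) = φ (g j) by rw [← map_mul, mul_inv_cancel_left])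
          (b i) (T ((g i)⁻¹ * g j) (mul rfl (inv rfl (a i)) (a j))))
        (inv rfl (b j)))

end FellBundle
end

/-! Both claims come from one computation. Take a representation `π` of the finitely supported
sections of `A` in a C*-algebra `C`, a completely positive map `M` from `C` to `Reduced B`, and
elements `aᵢ`, `bᵢ` of the fibres over `gᵢ` and `φ(gᵢ)`. The Gram matrix with entries `π(aᵢ)* π(aⱼ)
= π(aᵢ* aⱼ)` is positive, so its entrywise image `(M(π(aᵢ* aⱼ)))` is positive too; this is the only
place where complete positivity, rather than positivity, matters. Compressing a positive matrix by a
row keeps it positive, hence `∑ λ(bᵢ) M(π(aᵢ* aⱼ)) λ(bⱼ)* ≥ 0` in `Reduced B`.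

It remains to apply the coefficient at the unit. It is a positive map, because on a section `f` it
sends `λ(f)* λ(f)` to `⟨f, f⟩`; this is `toUnit_E_one_nonneg`. The coefficients also form a graded
bimodule map: `E_lam_mul` and `E_mul_lam` let `λ(bᵢ)` and `λ(bⱼ)*` out of `E` while shifting the
index. As `φ` is multiplicative, the index of the middle factor becomes `φ(gᵢ⁻¹ gⱼ)`, so the `(i,
j)` term is exactly `bᵢ T(aᵢ* aⱼ) bⱼ*`.

The first claim is the case where `π` is the regular representation. The second takes for `π` the
universal representation `kappa`, and for `M` the map `Φ` followed by the `*`-homomorphism `Lambda`,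
which is again completely positive. -/

/-- A positive element of a C*-algebra is of the form `y* y`. -/
theorem CStarAlgebra.exists_eq_star_mul_self {C : Type*} [NonUnitalCStarAlgebra C]
    [PartialOrder C] [StarOrderedRing C] {x : C} (hx : 0 ≤ x) : ∃ y, x = star y * y :=
  CStarAlgebra.nonneg_iff_eq_star_mul_self.mp hx

/-! ### Positive matrices over a C*-algebra -/

namespace CStarMatrix

variable {C : Type*} [NonUnitalCStarAlgebra C] [PartialOrder C] [StarOrderedRing C]

/-- The matrix `(xᵢ* xⱼ)` is positive. -/
theorem nonneg_of_star_mul {n : ℕ} (x : Fin n → C) :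
    0 ≤ (ofMatrix fun i j => star (x i) * x j : CStarMatrix (Fin n) (Fin n) C) := by
  -- The square root built below needs a row index `k`, which exists only for `n > 0`; for `n = 0`
  -- all matrices are equal.
  rcases isEmpty_or_nonempty (Fin n) with h | ⟨⟨k⟩⟩
  · exact (CStarMatrix.ext fun i => h.elim i).le
  -- The row `(xⱼ)` is padded with zeros to a square matrix, so that `R* R` is formed inside a
  -- single C*-algebra. Only the summand of index `k` survives in each entry of `R* R`.
  · let R : CStarMatrix (Fin n) (Fin n) C := ofMatrix fun i j => if i = k then x j else 0
    have hR : (ofMatrix fun i j => star (x i) * x j) = star R * R := by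
      refine CStarMatrix.ext fun i j => ?_
      rw [mul_apply, Finset.sum_eq_single k]
      · have h (m : Fin n) : R k m = x m := if_pos rfl
        rw [star_apply, h, h]
        rfl
      · intro l _ hl
        have h : R l j = 0 := if_neg hl
        rw [h, MulZeroClass.mul_zero]
      · simp
    rw [hR]
    exact star_mul_self_nonneg R

/-- `∑ i j, bᵢ Nᵢⱼ bⱼ*` is positive for a positive matrix `N`. -/
theorem sum_mul_mul_star_nonneg {n : ℕ} {N : CStarMatrix (Fin n) (Fin n) C} (hN : 0 ≤ N)
    (b : Fin n → C) : 0 ≤ ∑ i, ∑ j, b i * N i j * star (b j) := by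
  obtain ⟨D, rfl⟩ := CStarAlgebra.exists_eq_star_mul_self hN
  -- Expanding `Nᵢⱼ = ∑ₖ Dₖᵢ* Dₖⱼ` and summing over `i` and `j` first gives `∑ₖ cₖ cₖ*` with `cₖ =
  -- ∑ᵢ bᵢ Dₖᵢ*`. No unit of `C` is needed.
  have key : ∑ i, ∑ j, b i * (star D * D) i j * star (b j) =
      ∑ k, (∑ i, b i * star (D k i)) * star (∑ i, b i * star (D k i)) := by
    have h : ∀ k, (∑ i, b i * star (D k i)) * star (∑ i, b i * star (D k i)) =
        ∑ i, ∑ j, b i * (star (D k i) * D k j) * star (b j) := fun k => by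
      simp only [star_sum, star_mul, star_star, Finset.sum_mul_sum, mul_assoc]
    simp only [h, mul_apply, star_apply, Finset.mul_sum, Finset.sum_mul]
    -- Both sides are now the same triple sum, up to the order of summation.
    rw [Finset.sum_comm (s := Finset.univ (α := Fin n))]
    rw [Finset.sum_comm]
    conv_rhs => rw [Finset.sum_comm]
    exact Finset.sum_congr rfl fun i _ => Finset.sum_comm
  rw [key]
  exact Finset.sum_nonneg fun k _ => mul_star_self_nonneg _

end CStarMatrix

/-! ### Composition with `*`-homomorphisms -/

namespace CompletelyPositiveMap

variable {C₁ C₂ C₃ : Type*} [NonUnitalCStarAlgebra C₁] [NonUnitalCStarAlgebra C₂]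
  [NonUnitalCStarAlgebra C₃] [PartialOrder C₁] [PartialOrder C₂] [PartialOrder C₃]
  [StarOrderedRing C₁] [StarOrderedRing C₂] [StarOrderedRing C₃]

/-- The composition of a completely positive map with a `*`-homomorphism. -/
def postcomp (F : C₂ →⋆ₙₐ[ℂ] C₃) (Φ : CompletelyPositiveMap C₁ C₂) :
    CompletelyPositiveMap C₁ C₃ where
  toLinearMap := (F : C₂ →ₗ[ℂ] C₃) ∘ₗ Φ.toLinearMap
  map_cstarMatrix_nonneg' k N hN :=
    -- A `*`-homomorphism is itself completely positive: applied entrywise, it is a `*`-homomorphism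
    -- of matrix algebras.
    CompletelyPositiveMapClass.map_cstarMatrix_nonneg' F k _ (Φ.map_cstarMatrix_nonneg' k N hN)

end CompletelyPositiveMap

/-! ### Fourier coefficients: bimodule property and positivity -/

namespace FellBundle

variable {G : Type u} [Group G] {A : G → Type v} [∀ g, NormedAddCommGroup (A g)]
  [∀ g, NormedSpace ℂ (A g)] [∀ g, CompleteSpace (A g)] [FellBundle A]

theorem Reduced.induction {P : Reduced A → Prop} (x : Reduced A) (hp : IsClosed {x | P x})
    (h : ∀ f, P (toReduced A f)) : P x := denseRange_toReduced.induction_on x hp h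

/-- The fibre product as a bounded bilinear map. -/
noncomputable def mulL {g h k : G} (e : g * h = k) : A g →L[ℂ] A h →L[ℂ] A k :=
  (mulₗ A e).mkContinuous₂ 1 fun a b => by
    rw [_root_.one_mul]
    exact norm_mul_le e a b

theorem mulL_apply {g h k : G} (e : g * h = k) (a : A g) (b : A h) :
    mulL e a b = mul e a b := rfl

/-- On finitely supported sections this is the formula `(a f)(g k) = a f(k)`. Both sides are
continuous in `x`, the right one because the fibre product is bounded, so density of the sections
gives the general case. Together with its mirror image `E_mul_lam`, it makes `E` a graded bimodule
map. -/
theorem E_lam_mul {g k l : G} (e : g * k = l) (a : A g) (x : Reduced A) :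
    E A l (lam A g a * x) = mul e a (E A k x) := by
  induction x using Reduced.induction with
  | hp =>
    exact isClosed_eq ((E A l).continuous.comp (continuous_const.mul continuous_id))
      ((mulL e a).continuous.comp (E A k).continuous)
  | h f =>
    change E A l (toReduced A (j A g a) * toReduced A f) = _
    rw [← map_mul, E_toReduced, E_toReduced, ev_j_mul e]

theorem E_mul_lam {k h l : G} (e : k * h = l) (x : Reduced A) (b : A h) :
    E A l (x * lam A h b) = mul e (E A k x) b := by
  induction x using Reduced.induction with
  | hp =>
    exact isClosed_eq ((E A l).continuous.comp (continuous_id.mul continuous_const))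
      (((mulL e).flip b).continuous.comp (E A k).continuous)
  | h f =>
    change E A l (toReduced A f * toReduced A (j A h b)) = _
    rw [← map_mul, E_toReduced, E_toReduced, ev_mul_j e]

theorem star_lam {g k : G} (e : g⁻¹ = k) (a : A g) : star (lam A g a) = lam A k (inv e a) := by
  change star (toReduced A (j A g a)) = toReduced A (j A k _)
  rw [← map_star, star_j e]

/-- The coefficient at the unit is a positive map. -/
theorem toUnit_E_one_nonneg {x : Reduced A} (hx : 0 ≤ x) : 0 ≤ toUnit A (E A 1 x) := by
  obtain ⟨y, rfl⟩ := CStarAlgebra.nonneg_iff_eq_star_mul_self.mp hx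
  -- The approximation is carried out on the square root `y`, not on `x`: sections close to `x` need
  -- not be positive, whereas `y* y` stays positive for every `y`. The positivity of `x` has served
  -- its purpose.
  clear hx
  have hc : Continuous (toUnit A) := continuous_id (X := A 1)
  induction y using Reduced.induction with
  | hp =>
    exact CStarAlgebra.isClosed_nonneg.preimage
      (hc.comp ((E A 1).continuous.comp (continuous_star.mul continuous_id)))
  | h f =>
    -- For `y = λ(f)` the coefficient is `(f* f)(1) = ⟨f, f⟩`, a sum of positive elements `f(h)*
    -- f(h)`.
    rw [← map_star, ← map_mul, E_toReduced, ← ip_eq]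
    exact ip_self_nonneg f

/-- The Fourier coefficients of a completely positive map composed with a contractive
representation `π` of the bundle form a positive definite bundle map. -/
theorem exists_isPositiveDefinite {H : Type w} [Group H] {B : H → Type x}
    [∀ h, NormedAddCommGroup (B h)] [∀ h, NormedSpace ℂ (B h)] [∀ h, CompleteSpace (B h)]
    [FellBundle B] (φ : G →* H) {C : Type*} [NonUnitalCStarAlgebra C] [PartialOrder C]
    [StarOrderedRing C] (π : Cc A →⋆ₙₐ[ℂ] C) (hπ : ∀ (g : G) (a : A g), ‖π (j A g a)‖ ≤ ‖a‖)
    (M : CompletelyPositiveMap C (Reduced B)) :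
    ∃ T : BundleMap A φ B, (∀ (g : G) (a : A g), T g a = E B (φ g) (M (π (j A g a)))) ∧
      T.IsPositiveDefinite := by
  let πL (g : G) : A g →L[ℂ] C := ((π : Cc A →ₗ[ℂ] C) ∘ₗ j A g).mkContinuous 1 fun a => by
    rw [_root_.one_mul]
    exact hπ g a
  -- Boundedness of `M` is automatic, as for every positive map between C*-algebras. With the bound
  -- on `π` over each fibre, it makes every `T g` bounded.
  let ML : C →L[ℂ] Reduced B := ⟨(M : C →ₗ[ℂ] Reduced B), map_continuous M⟩
  refine ⟨fun g => (E B (φ g)).comp (ML.comp (πL g)), fun g a => rfl, fun n g a b => ?_⟩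
  -- The entrywise image under `M` of the Gram matrix of the `π(aᵢ)`.
  have hN := M.map_cstarMatrix_nonneg _
    (CStarMatrix.nonneg_of_star_mul fun i => π (j A (g i) (a i)))
  -- The coefficient at the unit of `∑ λ(bᵢ) M(π(aᵢ)* π(aₖ)) λ(bₖ)*`, to be identified term by term
  -- with the required sum.
  have hpos := toUnit_E_one_nonneg
    (CStarMatrix.sum_mul_mul_star_nonneg hN fun i => lam B (φ (g i)) (b i))
  simp only [map_sum] at hpos
  refine hpos.trans_eq (Finset.sum_congr rfl fun i _ => Finset.sum_congr rfl fun k _ => ?_)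
  -- Removing `λ(bₖ)*` on the right moves the index of `E` from `1` to `φ(gₖ)`; removing `λ(bᵢ)` on
  -- the left then moves it to `φ(gᵢ⁻¹ gₖ)`, by this identity. That is the index of `T` on `aᵢ* aₖ`.
  have e : φ (g i) * φ ((g i)⁻¹ * g k) = φ (g k) := by rw [← map_mul, mul_inv_cancel_left]
  rw [star_lam rfl, E_mul_lam (mul_inv_cancel (φ (g k))), E_lam_mul e, CStarMatrix.map_apply]
  change toUnit B (mul _ (mul _ _ (E B _ (M (star (π _) * π _)))) _) = _
  rw [← map_star, ← map_mul, star_j rfl, j_mul_j rfl]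
  rfl

end FellBundle

/-- The formulas determine `T`, so the existential says that they define bounded maps, and that this
bundle map is positive definite. The bounds on the fibres hold for both representations because
every C*-seminorm on the sections is at most the norm of `A g` on the image of `A g`. -/
theorem proposition3p8 {G H : Type*} [Group G] [Group H]
    (A : G → Type*) [∀ g, NormedAddCommGroup (A g)] [∀ g, NormedSpace ℂ (A g)]
    [∀ g, CompleteSpace (A g)] [FellBundle A]
    (B : H → Type*) [∀ h, NormedAddCommGroup (B h)] [∀ h, NormedSpace ℂ (B h)]
    [∀ h, CompleteSpace (B h)] [FellBundle B] (φ : G →* H) :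
    (∀ M : CompletelyPositiveMap (FellBundle.Reduced A) (FellBundle.Reduced B),
      ∃ T : FellBundle.BundleMap A φ B,
        (∀ (g : G) (a : A g), T g a = FellBundle.E B (φ g) (M (FellBundle.lam A g a))) ∧
        T.IsPositiveDefinite) ∧
    (∀ Φ : CompletelyPositiveMap (FellBundle.Full A) (FellBundle.Full B),
      ∃ T : FellBundle.BundleMap A φ B,
        (∀ (g : G) (a : A g), T g a =
          FellBundle.E B (φ g) (FellBundle.Lambda B (Φ (FellBundle.jHat A g a)))) ∧
        T.IsPositiveDefinite) := by
  refine ⟨fun M => ?_, fun Φ => ?_⟩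
  · exact FellBundle.exists_isPositiveDefinite φ (FellBundle.toReduced A)
      (FellBundle.seminorm_j_le (FellBundle.redSeminorm A)) M
  · exact FellBundle.exists_isPositiveDefinite φ (FellBundle.kappa A)
      (fun g a => (FellBundle.norm_kappa _).trans_le
        (FellBundle.seminorm_j_le (FellBundle.univ A) g a))
      (Φ.postcomp (FellBundle.Lambda B))
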